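/- **Protocol.** There are $N\ge 1$ voters, an honest tallier $T$, and qudits of dimension $D>N$; put $|\psi(\theta)\rangle=D^{-1/2}\sum_{j=0}^{D-1}e^{ij\theta}|j\rangle$. *Setup:* $T$ draws once, independently, $l_y$ uniformly in $\{0,\dots,D-1\}$ and $\delta$ uniformly in $[0,2\pi/D)$, and chooses $l_n\neq l_y$ in any way (possibly at random and depending on $l_y,\delta$) with $N\Delta<D$, where $\Delta=(l_y-l_n \bmod D)$; $\theta_v=2\pi l_v/D+\delta$. With these secret values $\rho$ rounds are run, each with fresh quantum states: each voter gets one qudit of $D^{-1/2}\sum_j|j\rangle^{\otimes N}$ and the option qudits $|\psi(\theta_y)\rangle,|\psi(\theta_n)\rangle$. *Casting:* voter $k$ appends the option qudit of the vote to the ballot qudit, measures $\{P_r\}$, $P_r=\sum_j|j+r\rangle\langle j+r|\otimes|j\rangle\langle j|$ (indices mod $D$), applies $U_{r_k}=\mathbb I\otimes\sum_j|j+r_k\rangle\langle j|$ for the outcome $r_k$, and sends both qudits and $r_k$ to $T$. *Tally:* for each $k$, $T$ multiplies $|j\rangle$, $j<r_k$, by $e^{-iD\delta}$ on one qudit, applies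 $\sum_j e^{-ijN\theta_n}|j\rangle\langle j|$ on one qudit, and measures for $\Omega_q=D^{-1/2}\sum_je^{2\pi ijq/D}|j\rangle^{\otimes 2N}$, $0\le q<D$. The round's result is the number $q/\Delta$ of yes votes, or $\bot$ if there is no such $q$ or $\Delta\nmid q$. The election result $X$ is the common result of all rounds, or $\bot$ if two rounds disagree. **Integrity experiment.** The adversary chooses all votes and which voters to corrupt, and casts the ballots of the corrupted voters. $\mathbf{EXP}_{\mathsf{Qint}}$ outputs $1$ iff $X\ne\bot$ and either the result ($X$ yes votes, $\max(N-X,0)$ no votes) does not contain all honest votes, i.e. has fewer yes votes or fewer no votes than the honest voters cast, or it contains more than $N$ votes. **The $d$-transfer adversary.** Let $n=\max(\lfloor(\epsilon N-1)/2\rfloor,0)$. The adversary corrupts $2n+1\le\epsilon N$ voters: $n$ who vote yes, $n$ who vote no (these $2n$ cast honestly) and one, $t$, who uses the yes qudit. In each round it measures the $n$ unused yes qudits and the $n$ unused no qudits with the POVM $E(\theta)=\frac{D}{2\pi}|\psi(\theta)\rangle\langle\psi(\theta)|$, $\theta\in[0,2\pi)$. For each option $v$, $\mathrm{Algo}(v)$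 lists in increasing order the $l\in\{0,\dots,D-1\}$ such that at least $40\%$ of the $n$ outcomes lie in $[2\pi l/D,2\pi(l+1)/D)$, reverses the list if it is $[0,D-1]$, and returns its first entry ($0$ if it is empty). With $\varphi=2\pi(\mathrm{Algo}(y)-\mathrm{Algo}(n))/D$, voter $t$ applies $\sum_je^{ijd\varphi}|j\rangle\langle j|$ to the yes qudit, then casts as prescribed, and before sending the ballot multiplies $|j\rangle$, $j<r_t$, by $e^{-iDd\varphi}$ on the option qudit. Here $1\le d\le$ the total number of no votes. **Theorem.** For every $0<\epsilon<1$ there is a constant $c>0$, depending only on $\epsilon$, such that for all $N$, all $D>N$, all numbers of rounds $2\le\rho\le e^{cN}$ and every admissible way of choosing $l_n$: 1. for every choice of the corrupted voters, the votes and $d$ as above, with probability at least $0.25$ the election result is $X=m+d$, where $m$ is the number of yes votes of all voters; 2. if moreover $d$ exceeds the number $n$ of corrupted voters who vote no, the adversary wins: $\Pr[1\leftarrow\mathbf{EXP}_{\mathsf{Qint}}]\ge 0.25$; and such choices of the corrupted voters, the votes and $d$ exist. Integrity is therefore violated by double voting. -/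

import Mathlib

open MeasureTheory ProbabilityTheory
open scoped ENNReal Matrix

/-! Distributed-ballot quantum voting with `N` voters and qudits of dimension `D`.
The computational basis is `Fin D`; addition and subtraction in `Fin D` are modulo `D`.
A vote is a `Bool`, with `true` for yes and `false` for no. -/

namespace QVote

/-! ### Option qudits and their phase measurement -/

/-- The qudit `D^(-1/2) ∑ⱼ exp(i j θ) |j⟩`. -/
noncomputable def phaseState (D : ℕ) (θ : ℝ) : Fin D → ℂ :=
  fun j => ((1 / Real.sqrt D : ℝ) : ℂ) * Complex.exp (Complex.I * (j : ℕ) * θ)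

/-- The POVM density `E(θ) = D/(2π) |Φ(θ)⟩⟨Φ(θ)|`, where `Φ(θ) = phaseState D θ`. -/
noncomputable def phasePOVM (D : ℕ) (θ : ℝ) : Matrix (Fin D) (Fin D) ℂ :=
  ((D / (2 * Real.pi) : ℝ) : ℂ) • Matrix.vecMulVec (phaseState D θ) (star (phaseState D θ))

/-- The law, on the angles in `[0, 2π)`, of the outcome of measuring the state `ψ` with the POVM
`E(θ)`: its density is `⟨ψ| E(θ) |ψ⟩`. -/
noncomputable def angleLaw (D : ℕ) (ψ : Fin D → ℂ) : Measure ℝ :=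
  (volume.restrict (Set.Ico 0 (2 * Real.pi))).withDensity
    (fun θ => ENNReal.ofReal (star ψ ⬝ᵥ (phasePOVM D θ *ᵥ ψ)).re)

/-! ### Setup phase -/

/-- The secret values `(l_y, l_n, δ)` of the tallier. -/
abbrev Params (D : ℕ) : Type := Fin D × Fin D × ℝ

/-- `l_y` for `true` and `l_n` for `false`. -/
def Params.l {D : ℕ} (p : Params D) (v : Bool) : Fin D := if v then p.1 else p.2.1

/-- `θ_v = 2π l_v / D + δ`. -/
noncomputable def Params.theta {D : ℕ} (p : Params D) (v : Bool) : ℝ :=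
  2 * Real.pi * (p.l v : ℕ) / D + p.2.2

/-- `l_y - l_n mod D`, as a number in `{0, …, D-1}`. -/
def Params.diff {D : ℕ} (p : Params D) : ℕ := ((p.l true - p.l false : Fin D) : ℕ)

/-- `μ` is a possible law of the secret values: `l_y` is uniform on `{0, …, D-1}`, `δ` is uniform on
`[0, 2π/D)`, the two are independent, and `l_n` is chosen in any way (possibly at random, and
depending on `l_y` and `δ`) such that `l_n ≠ l_y` and `N (l_y - l_n mod D) < D`. -/
structure IsSetupLaw (N D : ℕ) (μ : Measure (Params D)) : Prop where
  isProbabilityMeasure : IsProbabilityMeasure μ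
  uniform : μ.map (fun p => (p.1, p.2.2)) =
    (uniformOn (Set.univ : Set (Fin D))).prod
      (cond (volume : Measure ℝ) (Set.Ico 0 (2 * Real.pi / D)))
  admissible : ∀ᵐ p ∂μ, p.diff ≠ 0 ∧ N * p.diff < D

/-- Basis labels of the `2N` qudits of one round: for every voter the blank ballot qudit and the
option qudit that is appended to it. -/
abbrev Reg (N D : ℕ) : Type := Fin N → Fin D × Fin D

/-- The amplitudes of the ballot state `D^(-1/2) ∑ⱼ |j⟩^{⊗N}`. -/
noncomputable def blankBallot (N D : ℕ) (b : Fin N → Fin D) : ℂ :=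
  ((1 / Real.sqrt D : ℝ) : ℂ) * ∑ j : Fin D, if ∀ k, b k = j then 1 else 0

/-- The ballot state together with the option qudits that the voters select. -/
noncomputable def initState {N D : ℕ} (p : Params D) (votes : Fin N → Bool) : Reg N D → ℂ :=
  fun s => blankBallot N D (fun k => (s k).1) *
    ∏ k, phaseState D (p.theta (votes k)) (s k).2

/-! ### Casting phase -/

/-- Operators on the (ballot, option) pair of qudits of one voter. -/
abbrev PairOp (D : ℕ) : Type := Matrix (Fin D × Fin D) (Fin D × Fin D) ℂ

/-- The projector `P_r = ∑ⱼ |j+r⟩⟨j+r| ⊗ |j⟩⟨j|`. -/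
def projP {D : ℕ} (r : Fin D) : PairOp D :=
  Matrix.diagonal fun x => if x.1 = x.2 + r then 1 else 0

/-- The unitary `U_r = 1 ⊗ ∑ⱼ |j+r⟩⟨j|`. -/
def shiftU {D : ℕ} (r : Fin D) : PairOp D :=
  Matrix.of fun x z => if x = (z.1, z.2 + r) then 1 else 0

/-- `CastBallot`: the Kraus operator of an honest voter who obtains and announces `r`. -/
def castBallot {D : ℕ} (r : Fin D) : PairOp D := shiftU r * projP r

/-- The operator `⨂ₖ Kₖ`, where `Kₖ` acts on the pair of voter `k`. (Operations on different voters'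
pairs commute, so the casting order plays no role.) -/
noncomputable def tensorApply {N D : ℕ} (K : Fin N → PairOp D) (ψ : Reg N D → ℂ) : Reg N D → ℂ :=
  fun s => ∑ t : Reg N D, (∏ k, K k (s k) (t k)) * ψ t

/-! ### Tally phase of one round -/

/-- The diagonal entries of `W_k` for the announced result `r`. -/
noncomputable def corrW {D : ℕ} (p : Params D) (r j : Fin D) : ℂ :=
  if j < r then Complex.exp (-Complex.I * D * p.2.2) else 1

/-- The amplitudes of `Ω_q = D^(-1/2) ∑ⱼ exp(2π i j q / D) |j⟩^{⊗2N}`. -/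
noncomputable def omega (N D : ℕ) (q : Fin D) : Reg N D → ℂ :=
  fun s => ((1 / Real.sqrt D : ℝ) : ℂ) * ∑ j : Fin D, if ∀ k, s k = (j, j) then
    Complex.exp (2 * Real.pi * Complex.I * (j : ℕ) * (q : ℕ) / D) else 0

/-- What the tallier does to the cast ballots before the final measurement: `W_k` on the ballot qudit
of voter `k`, for every `k`, then `∑ⱼ exp(-i j N θ_n) |j⟩⟨j|` on one ballot qudit. -/
noncomputable def tallyState {N D : ℕ} [NeZero N] (p : Params D) (r : Fin N → Fin D)
    (ψ : Reg N D → ℂ) : Reg N D → ℂ :=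
  fun s => Complex.exp (-Complex.I * ((s 0).1 : ℕ) * N * p.theta false) *
    ((∏ k, corrW p (r k) (s k).1) * ψ s)

/-- The amplitude of the outcome `Ω_q` of the final measurement, given the announced results `r`. -/
noncomputable def tallyAmp {N D : ℕ} [NeZero N] (p : Params D) (r : Fin N → Fin D)
    (ψ : Reg N D → ℂ) (q : Fin D) : ℂ :=
  ∑ s, star (omega N D q s) * tallyState p r ψ s

/-- The number of yes votes that the tallier derives from the measurement of a round. The outcome
`none` (no `Ω_q` was found, so some ballot is invalid) and an outcome `q` that is not a multiple of
`l_y - l_n mod D` give the result `⊥`. -/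
def decode {D : ℕ} (p : Params D) : Option (Fin D) → Option ℕ
  | none => none
  | some q => if p.diff ∣ (q : ℕ) then some ((q : ℕ) / p.diff) else none

/-- The result of the election from those of the `ρ` rounds: their common value, or `⊥` if two
rounds disagree. -/
def electionResult {ρ : ℕ} (X : Fin ρ → Option ℕ) : Option ℕ :=
  if h : 0 < ρ then (if ∀ i, X i = X ⟨0, h⟩ then X ⟨0, h⟩ else none) else none

/-! ### Adversaries and the integrity experiment -/

/-- An adversary against the protocol that chooses all votes and a set of corrupted voters and, in
every round, measures the unused option qudits of the corrupted voters with `E(θ)` and then casts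
their ballots by local quantum operations that may depend on all angles `y` so obtained; `cast y k r`
is the Kraus operator for voter `k` announcing `r`. It returns the honest ballots untouched. -/
structure Adversary (N D : ℕ) where
  votes : Fin N → Bool
  corrupted : Finset (Fin N)
  cast : ({k // k ∈ corrupted} → ℝ) → {k // k ∈ corrupted} → Fin D → PairOp D
  complete : ∀ y k, ∑ r, (cast y k r)ᴴ * cast y k r = 1
  measurable_cast : ∀ k r a b, Measurable fun y => cast y k r a b

namespace Adversary

variable {N D : ℕ}

/-- The joint law of the measured angles: the unused option qudit of voter `k` is in the state
`phaseState D (θ_v)` for the option `v` that `k` does not use. -/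
noncomputable def probeLaw (A : Adversary N D) (p : Params D) :
    Measure ({k // k ∈ A.corrupted} → ℝ) :=
  Measure.pi fun k => angleLaw D (phaseState D (p.theta (!A.votes k)))

/-- The Kraus operator with which voter `k` casts, given the angles `y`. -/
noncomputable def kraus (A : Adversary N D) (y : {k // k ∈ A.corrupted} → ℝ) (k : Fin N)
    (r : Fin D) : PairOp D :=
  if h : k ∈ A.corrupted then A.cast y ⟨k, h⟩ r else castBallot r

/-- The probability that the tallier measures `Ω_q` in one round with secret values `p`. -/
noncomputable def roundProb [NeZero N] (A : Adversary N D) (p : Params D) (q : Fin D) : ℝ≥0∞ :=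
  ∫⁻ y, ∑ r : Fin N → Fin D, ENNReal.ofReal
    (‖tallyAmp p r (tensorApply (fun k => A.kraus y k (r k)) (initState p A.votes)) q‖ ^ 2)
    ∂A.probeLaw p

/-- The law of the tallier's measurement outcome in one round. -/
noncomputable def roundLaw [NeZero N] (A : Adversary N D) (p : Params D) : Option (Fin D) → ℝ≥0∞
  | none => 1 - ∑ q, A.roundProb p q
  | some q => A.roundProb p q

open Classical in
/-- The probability that the election result satisfies `E`, when the secret values are drawn once
from `μ` and then `ρ` rounds are run with them, with fresh quantum states in every round. -/
noncomputable def resultProb [NeZero N] (A : Adversary N D) (μ : Measure (Params D)) (ρ : ℕ)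
    (E : Option ℕ → Prop) : ℝ≥0∞ :=
  ∫⁻ p, ∑ q : Fin ρ → Option (Fin D),
    (if E (electionResult fun i => decode p (q i)) then ∏ i, A.roundLaw p (q i) else 0) ∂μ

/-- The number of honest voters whose vote is `v`. -/
def honestCount (A : Adversary N D) (v : Bool) : ℕ :=
  (Finset.univ.filter fun k => k ∉ A.corrupted ∧ A.votes k = v).card

/-- `P_VCounted`: the result, `x` yes votes and `N - x` no votes, contains all the honest votes. -/
def VCounted (A : Adversary N D) (x : ℕ) : Prop :=
  A.honestCount true ≤ x ∧ A.honestCount false ≤ N - x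

/-- `Nballots`: the number of votes, yes and no, that the result `x` contains. -/
def nballots (N x : ℕ) : ℕ := x + (N - x)

/-- The condition on the election result under which the integrity experiment outputs `1`. -/
def Wins (A : Adversary N D) (X : Option ℕ) : Prop :=
  ∃ x, X = some x ∧ (¬ A.VCounted x ∨ N < nballots N x)

/-- `Pr[1 ← EXP_Qint(A)]` for the protocol with `ρ` rounds. -/
noncomputable def qintProb [NeZero N] (A : Adversary N D) (μ : Measure (Params D)) (ρ : ℕ) :
    ℝ≥0∞ :=
  A.resultProb μ ρ A.Wins

end Adversary

/-! ### Estimating `l_y - l_n` -/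

/-- `Record[j]`: how many of the angles `y i`, `i ∈ S`, lie in `[2πj/D, 2π(j+1)/D)`. -/
noncomputable def record {ι : Type*} (D : ℕ) (S : Finset ι) (y : ι → ℝ) (j : Fin D) : ℕ :=
  ∑ i ∈ S, (Set.Ico (2 * Real.pi * (j : ℕ) / D) (2 * Real.pi * ((j : ℕ) + 1) / D)).indicator
    (fun _ => 1) (y i)

/-- The vector `Solution`: the values that were recorded at least `40 %` of `n` times, in increasing
order, except that `[0, D-1]` is replaced by `[D-1, 0]`. -/
def solution {D : ℕ} (n : ℕ) (rec : Fin D → ℕ) : List (Fin D) :=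
  let S := (List.finRange D).filter fun l => 40 * n ≤ 100 * rec l
  if S.map Fin.val = [0, D - 1] then S.reverse else S

/-- The adversary's algorithm: the first entry of `Solution` (`0` if there is none). -/
noncomputable def algo {ι : Type*} {D : ℕ} [NeZero D] (S : Finset ι) (y : ι → ℝ) : Fin D :=
  (solution S.card (record D S y)).headD 0

lemma measurable_algo {ι : Type*} [Fintype ι] {D : ℕ} [NeZero D] (S : Finset ι) :
    Measurable fun y : ι → ℝ => (algo S y : Fin D) := by
  have h : Measurable fun y : ι → ℝ => record D S y := by
    refine measurable_pi_lambda _ fun j => ?_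
    unfold record
    refine Finset.measurable_sum _ fun i _ => ?_
    exact (measurable_const.indicator measurableSet_Ico).comp (measurable_pi_apply i)
  exact (Measurable.of_discrete (f := fun rec : Fin D → ℕ => (solution S.card rec).headD 0)).comp h

/-! ### The `d`-transfer adversary -/

/-- `C_d = ∑ⱼ exp(i j d φ) |j⟩⟨j|` on the option qudit. -/
noncomputable def opC {D : ℕ} (d : ℕ) (φ : ℝ) : PairOp D :=
  Matrix.diagonal fun x => Complex.exp (((((x.2 : ℕ) : ℝ) * d * φ : ℝ) : ℂ) * Complex.I)

/-- `Correct_r` on the option qudit: the phase `exp(-i D d φ)` on `|j⟩` for `j < r`. -/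
noncomputable def opCorrect {D : ℕ} (d : ℕ) (φ : ℝ) (r : Fin D) : PairOp D :=
  Matrix.diagonal fun x =>
    if x.2 < r then Complex.exp (((-(D * d * φ) : ℝ) : ℂ) * Complex.I) else 1

/-- How the corrupted voter who transfers `d` votes casts when `φ` is their value for `θ_y - θ_n`. -/
noncomputable def transferCast {D : ℕ} (d : ℕ) (φ : ℝ) (r : Fin D) : PairOp D :=
  opCorrect d φ r * castBallot r * opC d φ

/-- The free choices of the `d`-transfer adversary that corrupts a fraction `ε` of the voters.
All corrupted voters but one vote half yes and half no; their number is the largest even one that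
leaves the total at most `ε N`. The remaining one, `t`, uses the yes qudit and transfers `d` votes
from no to yes, where `d` is at most the number of no votes. -/
structure TransferPlan (N : ℕ) (ε : ℝ) where
  votes : Fin N → Bool
  corrupted : Finset (Fin N)
  t : Fin N
  d : ℕ
  t_mem : t ∈ corrupted
  votes_t : votes t = true
  card_le : (corrupted.card : ℝ) ≤ ε * N
  card_half : ∀ v, ((corrupted.erase t).filter fun k => votes k = v).card = ⌊(ε * N - 1) / 2⌋₊
  d_pos : 1 ≤ d
  d_le : d ≤ (Finset.univ.filter fun k => votes k = false).card

namespace TransferPlan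

variable {N : ℕ} {ε : ℝ}

/-- The number of yes votes that the voters are supposed to cast. -/
def yesVotes (P : TransferPlan N ε) : ℕ := (Finset.univ.filter fun k => P.votes k = true).card

/-- The corrupted voters other than `t` who do not use their option qudit for `v`. -/
def leftover (P : TransferPlan N ε) (v : Bool) : Finset {k // k ∈ P.corrupted} :=
  Finset.univ.filter fun k => k.1 ≠ P.t ∧ P.votes k = !v

/-- The adversary's value for `θ_y - θ_n` (modulo `2π`), namely `2π (Algo(y) - Algo(n)) / D`. -/
noncomputable def angleEstimate (P : TransferPlan N ε) (D : ℕ) [NeZero D]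
    (y : {k // k ∈ P.corrupted} → ℝ) : ℝ :=
  2 * Real.pi * ((algo (P.leftover true) y - algo (P.leftover false) y : Fin D) : ℕ) / D

end TransferPlan

lemma shiftU_unitary {D : ℕ} [NeZero D] (r : Fin D) : (shiftU r)ᴴ * shiftU r = 1 := by
  ext x z
  have : ∀ w : Fin D × Fin D, (star (if w = (x.1, x.2 + r) then (1 : ℂ) else 0)) *
      (if w = (z.1, z.2 + r) then (1 : ℂ) else 0) =
      if w = (x.1, x.2 + r) then (if x = z then 1 else 0) else 0 := by
    intro w
    by_cases h : w = (x.1, x.2 + r)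
    · subst h
      simp [Prod.ext_iff]
    · simp [h]
  simp only [Matrix.mul_apply, Matrix.conjTranspose_apply, shiftU, Matrix.of_apply, this,
    Matrix.one_apply]
  simp

lemma castBallot_complete {D : ℕ} [NeZero D] :
    ∑ r : Fin D, (castBallot r)ᴴ * castBallot r = 1 := by
  have h : ∀ r : Fin D, (castBallot r)ᴴ * castBallot r = projP r := by
    intro r
    rw [castBallot, Matrix.conjTranspose_mul, Matrix.mul_assoc, ← Matrix.mul_assoc (shiftU r)ᴴ,
      shiftU_unitary, Matrix.one_mul, projP, Matrix.diagonal_conjTranspose,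
      Matrix.diagonal_mul_diagonal]
    congr 1
    ext x
    by_cases hx : x.1 = x.2 + r <;> simp [hx]
  simp only [h]
  ext x z
  rw [Matrix.sum_apply]
  by_cases hxz : x = z
  · subst hxz
    have : ∀ r : Fin D, (x.1 = x.2 + r) ↔ r = x.1 - x.2 := fun r => by
      constructor
      · intro h; rw [h]; abel
      · intro h; rw [h]; abel
    simp [projP, this]
  · simp [projP, hxz]

lemma diagonal_phase_unitary {n : Type*} [Fintype n] [DecidableEq n] (f : n → ℂ)
    (hf : ∀ x, ‖f x‖ = 1) : (Matrix.diagonal f)ᴴ * Matrix.diagonal f = 1 := by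
  rw [Matrix.diagonal_conjTranspose, Matrix.diagonal_mul_diagonal, ← Matrix.diagonal_one]
  congr 1
  ext x
  have := Complex.conj_mul' (f x)
  simp only [Pi.star_apply, Complex.star_def, this, hf]
  simp

lemma transferCast_complete {D : ℕ} [NeZero D] (d : ℕ) (φ : ℝ) :
    ∑ r : Fin D, (transferCast d φ r)ᴴ * transferCast d φ r = 1 := by
  have hC : (opC (D := D) d φ)ᴴ * opC d φ = 1 :=
    diagonal_phase_unitary _ fun x => Complex.norm_exp_ofReal_mul_I _
  have h : ∀ r : Fin D, (transferCast d φ r)ᴴ * transferCast d φ r =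
      (opC d φ)ᴴ * ((castBallot r)ᴴ * castBallot r) * opC d φ := by
    intro r
    have hr : (opCorrect d φ r)ᴴ * opCorrect d φ r = 1 := by
      refine diagonal_phase_unitary _ fun x => ?_
      split_ifs
      · exact Complex.norm_exp_ofReal_mul_I _
      · simp
    calc (transferCast d φ r)ᴴ * transferCast d φ r
        = (opC d φ)ᴴ * ((castBallot r)ᴴ * (((opCorrect d φ r)ᴴ * opCorrect d φ r) * castBallot r))
            * opC d φ := by
          simp only [transferCast, Matrix.conjTranspose_mul, Matrix.mul_assoc]
      _ = _ := by rw [hr, Matrix.one_mul]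
  simp only [h]
  rw [← Finset.sum_mul, ← Finset.mul_sum, castBallot_complete, Matrix.mul_one, hC]

/-- The `d`-transfer adversary: `t` casts with the estimate of `θ_y - θ_n` that is obtained from the
unused option qudits of the other corrupted voters, who cast as honest voters do. -/
noncomputable def dTransferAdversary {N : ℕ} {ε : ℝ} (D : ℕ) [NeZero D] (P : TransferPlan N ε) :
    Adversary N D where
  votes := P.votes
  corrupted := P.corrupted
  cast y k r := if k.1 = P.t then transferCast P.d (P.angleEstimate D y) r else castBallot r
  complete y k := by
    by_cases h : k.1 = P.t
    · simp only [h, if_true]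
      exact transferCast_complete _ _
    · simp only [h, if_false]
      exact castBallot_complete
  measurable_cast k r a b := by
    by_cases h : k.1 = P.t
    · simp only [h, if_true]
      have hm : Measurable fun y : {k // k ∈ P.corrupted} → ℝ =>
          (algo (P.leftover true) y - algo (P.leftover false) y : Fin D) :=
        (Measurable.of_discrete (f := fun q : Fin D × Fin D => q.1 - q.2)).comp
          ((measurable_algo _).prodMk (measurable_algo _))
      exact (Measurable.of_discrete (f := fun l : Fin D =>
        transferCast P.d (2 * Real.pi * (l : ℕ) / D) r a b)).comp hm
    · simp only [h, if_false]
      exact measurable_const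

end QVote

/-!
The attack works because an unused option qudit carries a classical trace of `θ_v`. Measuring
`phaseState D θ` with the phase POVM gives an angle distributed around `θ` according to the Fejér
kernel (`phaseKernel`), whose width `2π / D` is exactly the resolution at which `θ_v = 2π l_v / D + δ`
determines `l_v`. If `δ` lies in the middle `30 %` of `[0, 2π / D)`, the bin of `l_v` receives the
outcome with probability at least `0.65` (`le_angleLaw_angleBin`; the bound `cos t ≥ 1 - t² / 2` is
enough, no closed form of the kernel is needed). By Hoeffding's inequality more than `60 %` of the `n`
outcomes then lie in this bin, except with probability `exp (-0.005 n)`; no other bin reaches `40 %`,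
so that `Algo` returns `l_v` (`pi_real_algo_ne_le`).

Given both `l_y` and `l_n`, the angle `φ` of the transferring voter is `θ_y - θ_n` modulo `2π`, and
the phase `exp (i j d φ)` turns that voter's ballot into one with `1 + d` yes votes. The phases which
the reductions modulo `D` of the shifted indices produce are those removed by the tallier's and the
adversary's corrections (`voter_phase`), so the tallied state is, up to a global phase, `Ω_q` with
`q = (m + d) (l_y - l_n)`, where `m` counts the yes votes, for all announced results
(`sum_norm_tallyAmp_transferCast`). Since `m + d ≤ N`, this `q` is below `D` and decodes to `m + d`.

Since `n` is about `ε N / 2`, Bernoulli's inequality over `ρ ≤ exp (ε N / 4000)` rounds leaves a failure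
probability of at most `1 / 6`, and `0.3 * (5 / 6) = 1 / 4`. If `d` exceeds the number of corrupted
no voters, the result `m + d` leaves fewer no votes than the honest voters cast
(`wins_dTransferAdversary`).
-/

namespace QVote

/-! ### The phase measurement of an option qudit -/

/-- The density at phase difference `x` of the outcome of the phase measurement of `phaseState`: the
Fejér kernel, in the form of a double sum of cosines. -/
noncomputable def phaseKernel (D : ℕ) (x : ℝ) : ℝ :=
  1 / (2 * Real.pi * D) * ∑ j : Fin D, ∑ k : Fin D, Real.cos ((((k : ℕ) : ℝ) - (j : ℕ)) * x)

lemma continuous_phaseKernel (D : ℕ) : Continuous (phaseKernel D) := by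
  unfold phaseKernel
  fun_prop

lemma phasePOVM_density {D : ℕ} [NeZero D] (θ y : ℝ) :
    (star (phaseState D θ) ⬝ᵥ (phasePOVM D y *ᵥ phaseState D θ)).re = phaseKernel D (θ - y) := by
  have hD : (0 : ℝ) < D := by exact_mod_cast Nat.pos_of_ne_zero (NeZero.ne D)
  have hs : Real.sqrt D * Real.sqrt D = D := Real.mul_self_sqrt hD.le
  have hs0 : Real.sqrt D ≠ 0 := (Real.sqrt_pos.2 hD).ne'
  have key : ∀ j k : Fin D, (star (phaseState D θ j) * (phasePOVM D y j k * phaseState D θ k)).re =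
      1 / (2 * Real.pi * D) * Real.cos ((((k : ℕ) : ℝ) - (j : ℕ)) * (θ - y)) := by
    intro j k
    have hstar : ∀ (j : Fin D) (θ : ℝ), star (phaseState D θ j) =
        ((1 / Real.sqrt D : ℝ) : ℂ) * Complex.exp (-(Complex.I * (j : ℕ) * θ)) := by
      intro j θ
      simp only [phaseState, Complex.star_def, map_mul, Complex.conj_ofReal, ← Complex.exp_conj,
        Complex.conj_I, Complex.conj_natCast, neg_mul]
    have h : star (phaseState D θ j) * (phasePOVM D y j k * phaseState D θ k) =
        ((1 / (2 * Real.pi * D) : ℝ) : ℂ) *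
          Complex.exp ((((((k : ℕ) : ℝ) - (j : ℕ)) * (θ - y) : ℝ) : ℂ) * Complex.I) := by
      simp only [phasePOVM, Matrix.smul_apply, Matrix.vecMulVec_apply, Pi.star_apply, hstar,
        smul_eq_mul]
      simp only [phaseState]
      have hc : ((1 / (2 * Real.pi * D) : ℝ) : ℂ) = ((1 / Real.sqrt D : ℝ) : ℂ) *
          (((D / (2 * Real.pi) : ℝ) : ℂ) * (((1 / Real.sqrt D : ℝ) : ℂ) *
            ((1 / Real.sqrt D : ℝ) : ℂ)) * ((1 / Real.sqrt D : ℝ) : ℂ)) := by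
        norm_cast
        have := Real.pi_ne_zero
        have h4 : Real.sqrt D ^ 4 = D * D := by
          calc Real.sqrt D ^ 4 = (Real.sqrt D * Real.sqrt D) * (Real.sqrt D * Real.sqrt D) := by ring
            _ = D * D := by rw [hs]
        field_simp
        rw [h4]
        ring
      have he : Complex.exp ((((((k : ℕ) : ℝ) - (j : ℕ)) * (θ - y) : ℝ) : ℂ) * Complex.I) =
          Complex.exp (-(Complex.I * (j : ℕ) * θ)) * (Complex.exp (Complex.I * (j : ℕ) * y) *
            Complex.exp (-(Complex.I * (k : ℕ) * y)) * Complex.exp (Complex.I * (k : ℕ) * θ)) := by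
        rw [← Complex.exp_add, ← Complex.exp_add, ← Complex.exp_add]
        congr 1
        push_cast
        ring
      rw [hc, he]
      ring
    rw [h, Complex.re_ofReal_mul, Complex.exp_ofReal_mul_I_re]
  simp only [dotProduct, Matrix.mulVec, Finset.mul_sum, Pi.star_apply, Complex.re_sum, key,
    phaseKernel]

lemma angleLaw_phaseState {D : ℕ} [NeZero D] (θ : ℝ) :
    angleLaw D (phaseState D θ) = (volume.restrict (Set.Ico 0 (2 * Real.pi))).withDensity
      fun y => ENNReal.ofReal (phaseKernel D (θ - y)) := by
  simp only [angleLaw, phasePOVM_density]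

lemma integral_cos_int_mul (m : ℤ) (θ : ℝ) :
    ∫ y in (0 : ℝ)..2 * Real.pi, Real.cos (m * (θ - y)) = if m = 0 then 2 * Real.pi else 0 := by
  split_ifs with hm
  · simp [hm]
  · have hm' : (m : ℝ) ≠ 0 := by exact_mod_cast hm
    simp only [mul_sub]
    rw [intervalIntegral.integral_comp_sub_mul _ hm', integral_cos, mul_zero, sub_zero,
      Real.sin_sub_int_mul_two_pi, sub_self, smul_zero]

lemma integral_phaseKernel {D : ℕ} [NeZero D] (θ : ℝ) :
    ∫ y in (0 : ℝ)..2 * Real.pi, phaseKernel D (θ - y) = 1 := by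
  have hD : (D : ℝ) ≠ 0 := by exact_mod_cast NeZero.ne D
  have hint : ∀ j k : Fin D,
      ∫ y in (0 : ℝ)..2 * Real.pi, Real.cos ((((k : ℕ) : ℝ) - (j : ℕ)) * (θ - y)) =
        if j = k then 2 * Real.pi else 0 := by
    intro j k
    have := integral_cos_int_mul (((k : ℕ) : ℤ) - ((j : ℕ) : ℤ)) θ
    push_cast at this
    rw [this]
    refine if_congr ?_ rfl rfl
    rw [sub_eq_zero, Nat.cast_inj, Fin.val_inj, eq_comm]
  simp only [phaseKernel]
  rw [intervalIntegral.integral_const_mul, intervalIntegral.integral_finsetSum]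
  · have : ∀ j : Fin D, ∫ y in (0 : ℝ)..2 * Real.pi,
        ∑ k : Fin D, Real.cos ((((k : ℕ) : ℝ) - (j : ℕ)) * (θ - y)) = 2 * Real.pi := by
      intro j
      rw [intervalIntegral.integral_finsetSum]
      · simp [hint]
      · intro k _
        exact Continuous.intervalIntegrable (by fun_prop) _ _
    simp only [this]
    have := Real.pi_ne_zero
    simp
    field_simp
  · intro j _
    exact Continuous.intervalIntegrable (by fun_prop) _ _

lemma phaseKernel_nonneg {D : ℕ} (x : ℝ) : 0 ≤ phaseKernel D x := by
  have h : ∑ j : Fin D, ∑ k : Fin D, Real.cos ((((k : ℕ) : ℝ) - (j : ℕ)) * x) =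
      (∑ j : Fin D, Real.cos ((j : ℕ) * x)) ^ 2 + (∑ j : Fin D, Real.sin ((j : ℕ) * x)) ^ 2 := by
    simp only [sq, Finset.sum_mul_sum, ← Finset.sum_add_distrib, sub_mul, Real.cos_sub]
    refine Finset.sum_congr rfl fun j _ => Finset.sum_congr rfl fun k _ => ?_
    ring
  unfold phaseKernel
  rw [h]
  have := Real.pi_pos
  positivity

lemma sum_sum_sub_sq (D : ℕ) :
    ∑ j : Fin D, ∑ k : Fin D, (((k : ℕ) : ℝ) - (j : ℕ)) ^ 2 = (D : ℝ) ^ 2 * ((D : ℝ) ^ 2 - 1) / 6 := by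
  have h1 : ∀ n : ℕ, ∑ k ∈ Finset.range n, (k : ℝ) = n * (n - 1) / 2 := by
    intro n
    induction n with
    | zero => simp
    | succ n ih => rw [Finset.sum_range_succ, ih]; push_cast; ring
  have h2 : ∀ n : ℕ, ∑ k ∈ Finset.range n, (k : ℝ) ^ 2 = n * (n - 1) * (2 * n - 1) / 6 := by
    intro n
    induction n with
    | zero => simp
    | succ n ih => rw [Finset.sum_range_succ, ih]; push_cast; ring
  have h3 : ∀ j k : ℝ, (k - j) ^ 2 = k ^ 2 + j ^ 2 - 2 * j * k := fun j k => by ring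
  have h4 : ∀ f : ℕ → ℝ, ∑ k : Fin D, f k = ∑ k ∈ Finset.range D, f k := fun f =>
    Fin.sum_univ_eq_sum_range f D
  have e1 := (h4 fun k => (k : ℝ)).trans (h1 D)
  have e2 := (h4 fun k => (k : ℝ) ^ 2).trans (h2 D)
  simp only [h3, Finset.sum_sub_distrib, Finset.sum_add_distrib, Finset.sum_const,
    Finset.card_univ, Fintype.card_fin, nsmul_eq_mul, ← Finset.mul_sum, ← Finset.sum_mul, e1, e2]
  ring

/-- Quadratic lower bound of the Fejér kernel near its peak, from `cos t ≥ 1 - t² / 2`. -/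
lemma le_phaseKernel {D : ℕ} [NeZero D] (x : ℝ) :
    D / (2 * Real.pi) * (1 - D ^ 2 * x ^ 2 / 12) ≤ phaseKernel D x := by
  have hD : (0 : ℝ) < D := by exact_mod_cast Nat.pos_of_ne_zero (NeZero.ne D)
  have hpi := Real.pi_pos
  have h : (D : ℝ) ^ 2 * (1 - D ^ 2 * x ^ 2 / 12) ≤
      ∑ j : Fin D, ∑ k : Fin D, Real.cos ((((k : ℕ) : ℝ) - (j : ℕ)) * x) := by
    calc (D : ℝ) ^ 2 * (1 - D ^ 2 * x ^ 2 / 12)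
        ≤ (D : ℝ) ^ 2 - x ^ 2 / 2 * ((D : ℝ) ^ 2 * ((D : ℝ) ^ 2 - 1) / 6) := by
          have : 0 ≤ (D : ℝ) ^ 2 * x ^ 2 := by positivity
          linarith
      _ = ∑ j : Fin D, ∑ k : Fin D, (1 - ((((k : ℕ) : ℝ) - (j : ℕ)) * x) ^ 2 / 2) := by
          have : ∀ j k : Fin D, 1 - ((((k : ℕ) : ℝ) - (j : ℕ)) * x) ^ 2 / 2 =
              1 - x ^ 2 / 2 * (((k : ℕ) : ℝ) - (j : ℕ)) ^ 2 := fun j k => by ring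
          simp only [this, Finset.sum_sub_distrib, ← Finset.mul_sum, sum_sum_sub_sq]
          simp [sq]
      _ ≤ _ := Finset.sum_le_sum fun j _ => Finset.sum_le_sum fun k _ =>
          Real.one_sub_sq_div_two_le_cos
  calc D / (2 * Real.pi) * (1 - D ^ 2 * x ^ 2 / 12)
      = 1 / (2 * Real.pi * D) * ((D : ℝ) ^ 2 * (1 - D ^ 2 * x ^ 2 / 12)) := by
        field_simp
    _ ≤ _ := by
        unfold phaseKernel
        gcongr

instance isProbabilityMeasure_angleLaw {D : ℕ} [NeZero D] (θ : ℝ) :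
    IsProbabilityMeasure (angleLaw D (phaseState D θ)) := by
  constructor
  have hc : Continuous fun y => phaseKernel D (θ - y) :=
    (continuous_phaseKernel D).comp (by fun_prop)
  rw [angleLaw_phaseState, withDensity_apply _ MeasurableSet.univ, Measure.restrict_univ,
    restrict_Ico_eq_restrict_Ioc,
    ← ofReal_integral_eq_lintegral_ofReal _ (ae_of_all _ fun y => phaseKernel_nonneg _),
    ← intervalIntegral.integral_of_le Real.two_pi_pos.le, integral_phaseKernel, ENNReal.ofReal_one]
  exact (hc.intervalIntegrable 0 (2 * Real.pi)).1

/-- The angles that `record` counts for `l`. -/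
def angleBin {D : ℕ} (l : Fin D) : Set ℝ :=
  Set.Ico (2 * Real.pi * (l : ℕ) / D) (2 * Real.pi * ((l : ℕ) + 1) / D)

/-- If the offset `δ` is in the middle of its range, then the phase measurement finds the right bin
with probability at least `0.65`: with `δ = 2π a / D` the quadratic bound of the kernel gives
`1 - (π² / 9) (a³ + (1 - a)³)`. -/
lemma le_angleLaw_angleBin {D : ℕ} [NeZero D] (l : Fin D) {δ : ℝ}
    (h1 : 0.35 * (2 * Real.pi / D) ≤ δ) (h2 : δ ≤ 0.65 * (2 * Real.pi / D)) :
    0.65 ≤ (angleLaw D (phaseState D (2 * Real.pi * (l : ℕ) / D + δ))).real (angleBin l) := by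
  have hD : (0 : ℝ) < D := by exact_mod_cast Nat.pos_of_ne_zero (NeZero.ne D)
  have hpi := Real.pi_pos
  obtain ⟨a, rfl⟩ : ∃ a, δ = 2 * Real.pi / D * a := ⟨δ / (2 * Real.pi / D), by field_simp⟩
  have hpos : 0 < 2 * Real.pi / D := by positivity
  have ha1 : 0.35 ≤ a := by
    rw [mul_comm] at h1
    exact le_of_mul_le_mul_left h1 hpos
  have ha2 : a ≤ 0.65 := by
    rw [mul_comm 0.65] at h2
    exact le_of_mul_le_mul_left h2 hpos
  set θ := 2 * Real.pi * (l : ℕ) / D + 2 * Real.pi / D * a with hθ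
  have hc : Continuous fun y => phaseKernel D (θ - y) :=
    (continuous_phaseKernel D).comp (by fun_prop)
  have hle : 2 * Real.pi * (l : ℕ) / D ≤ 2 * Real.pi * ((l : ℕ) + 1) / D := by
    gcongr
    linarith
  have hsub : angleBin l ⊆ Set.Ico 0 (2 * Real.pi) := by
    have hl : ((l : ℕ) : ℝ) + 1 ≤ D := by exact_mod_cast l.2
    refine Set.Ico_subset_Ico (by positivity) ?_
    rw [div_le_iff₀ hD]
    gcongr
  have heq : (angleLaw D (phaseState D θ)).real (angleBin l) =
      ∫ y in (2 * Real.pi * (l : ℕ) / D)..(2 * Real.pi * ((l : ℕ) + 1) / D),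
        phaseKernel D (θ - y) := by
    have hm : MeasurableSet (angleBin l) := measurableSet_Ico
    rw [Measure.real, angleLaw_phaseState, withDensity_apply _ hm,
      Measure.restrict_restrict hm, Set.inter_eq_left.2 hsub, angleBin,
      restrict_Ico_eq_restrict_Ioc,
      ← ofReal_integral_eq_lintegral_ofReal _ (ae_of_all _ fun y => phaseKernel_nonneg _),
      ← intervalIntegral.integral_of_le hle, ENNReal.toReal_ofReal]
    · exact intervalIntegral.integral_nonneg hle fun y _ => phaseKernel_nonneg _
    · exact (hc.intervalIntegrable _ _).1
  rw [heq]
  have hquad : ∫ y in (2 * Real.pi * (l : ℕ) / D)..(2 * Real.pi * ((l : ℕ) + 1) / D),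
      D / (2 * Real.pi) * (1 - D ^ 2 * (θ - y) ^ 2 / 12) =
        1 - Real.pi ^ 2 / 9 * (a ^ 3 + (1 - a) ^ 3) := by
    rw [intervalIntegral.integral_comp_sub_left
      (fun x => D / (2 * Real.pi) * (1 - D ^ 2 * x ^ 2 / 12)) θ]
    have h3 : ∀ x : ℝ, D / (2 * Real.pi) * (1 - D ^ 2 * x ^ 2 / 12) =
      D / (2 * Real.pi) - D ^ 3 / (24 * Real.pi) * x ^ 2 := fun x => by field_simp; ring
    simp only [h3]
    rw [intervalIntegral.integral_sub (by simp)
      (Continuous.intervalIntegrable (by fun_prop) _ _), intervalIntegral.integral_const_mul,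
      integral_pow, intervalIntegral.integral_const, hθ]
    simp only [smul_eq_mul]
    push_cast
    field_simp
    ring
  have hmono := intervalIntegral.integral_mono_on (μ := volume) hle
    (Continuous.intervalIntegrable (by fun_prop) _ _) (hc.intervalIntegrable _ _)
    fun y _ => le_phaseKernel (D := D) (θ - y)
  rw [hquad] at hmono
  refine le_trans ?_ hmono
  have hpi2 : Real.pi ^ 2 ≤ 9.87 := by
    have := Real.pi_lt_d4
    nlinarith
  -- `a³ + (1 - a)³ = 1 - 3 a (1 - a)` is largest at the ends of `[0.35, 0.65]`.
  have h5 : a ^ 3 + (1 - a) ^ 3 ≤ 0.3175 := by nlinarith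
  have h6 : 0 ≤ a ^ 3 + (1 - a) ^ 3 := by
    have : 0 ≤ 1 - a := by linarith
    have : 0 ≤ a := by linarith
    positivity
  nlinarith

/-! ### The estimate of `l_y - l_n` -/

/-- Hoeffding's inequality for the number of coordinates of a random point that lie in `B`, when
each of them does so with probability at least `q`. -/
lemma pi_real_sum_indicator_le {ι : Type*} [Fintype ι] (ν : ι → Measure ℝ)
    [∀ i, IsProbabilityMeasure (ν i)] (S : Finset ι) {B : Set ℝ} (hB : MeasurableSet B) {q η : ℝ}
    (hη : 0 ≤ η) (hq : ∀ i ∈ S, q ≤ (ν i).real B) :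
    (Measure.pi ν).real {y | ∑ i ∈ S, B.indicator (fun _ => (1 : ℝ)) (y i) ≤ (q - η) * S.card} ≤
      Real.exp (-2 * η ^ 2 * S.card) := by
  have hf : Measurable fun x : ℝ => -B.indicator (fun _ => (1 : ℝ)) x :=
    (measurable_const.indicator hB).neg
  set X : ι → (ι → ℝ) → ℝ := fun i y => -B.indicator (fun _ => (1 : ℝ)) (y i) + (ν i).real B
    with hX
  have hind : iIndepFun X (Measure.pi ν) :=
    iIndepFun_pi (X := fun i x => -B.indicator (fun _ => (1 : ℝ)) x + (ν i).real B)
      fun i => (hf.add_const _).aemeasurable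
  have hmean : ∀ i, ∫ y, -B.indicator (fun _ => (1 : ℝ)) (y i) ∂Measure.pi ν = -(ν i).real B := by
    intro i
    rw [integral_comp_eval (μ := ν) hf.aestronglyMeasurable, integral_neg,
      integral_indicator_const _ hB, smul_eq_mul, mul_one]
  have hsub : ∀ i ∈ S, HasSubgaussianMGF (X i) ((‖(0 : ℝ) - (-1)‖₊ / 2) ^ 2) (Measure.pi ν) := by
    intro i _
    have := hasSubgaussianMGF_of_mem_Icc (μ := Measure.pi ν)
      (X := fun y : ι → ℝ => -B.indicator (fun _ => (1 : ℝ)) (y i)) (a := -1) (b := 0)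
      (hf.comp (measurable_pi_apply i)).aemeasurable (ae_of_all _ fun y => by
        by_cases h : y i ∈ B <;> simp [h])
    simpa only [hmean, sub_neg_eq_add] using this
  have h := HasSubgaussianMGF.measure_sum_ge_le_of_iIndepFun hind hsub
    (ε := η * S.card) (by positivity)
  refine (measureReal_mono ?_).trans (h.trans (Real.exp_le_exp.2 ?_))
  · intro y hy
    simp only [Set.mem_ofPred_eq, hX, Finset.sum_add_distrib, Finset.sum_neg_distrib] at hy ⊢
    have : q * S.card ≤ ∑ i ∈ S, (ν i).real B := by
      calc q * S.card = ∑ i ∈ S, q := by simp [mul_comm]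
        _ ≤ _ := Finset.sum_le_sum hq
    linarith
  · rcases S.eq_empty_or_nonempty with rfl | hS
    · simp
    · have : (0 : ℝ) < S.card := by exact_mod_cast hS.card_pos
      simp
      field_simp
      norm_num

lemma disjoint_angleBin {D : ℕ} {l m : Fin D} (h : l < m) :
    Disjoint (angleBin l) (angleBin m) := by
  refine Set.disjoint_left.2 fun x hx hx' => ?_
  have hlm : (((l : ℕ) : ℝ) + 1) ≤ (m : ℕ) := by exact_mod_cast h
  have : 2 * Real.pi * (((l : ℕ) : ℝ) + 1) / D ≤ 2 * Real.pi * (m : ℕ) / D := by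
    have := Real.pi_pos
    gcongr
  exact absurd (hx.2.trans_le this) (not_lt.2 hx'.1)

lemma record_add_record_le {ι : Type*} {D : ℕ} (S : Finset ι) (y : ι → ℝ) {l m : Fin D}
    (h : l ≠ m) : record D S y l + record D S y m ≤ S.card := by
  have hd : Disjoint (angleBin l) (angleBin m) := by
    rcases lt_or_gt_of_ne h with h | h
    · exact disjoint_angleBin h
    · exact (disjoint_angleBin h).symm
  unfold record
  rw [← Finset.sum_add_distrib, Finset.card_eq_sum_ones]
  refine Finset.sum_le_sum fun i _ => ?_
  change (angleBin l).indicator _ (y i) + (angleBin m).indicator _ (y i) ≤ 1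
  by_cases hl : y i ∈ angleBin l
  · simp [hl, Set.disjoint_left.1 hd hl]
  · by_cases hm : y i ∈ angleBin m <;> simp [hl, hm]

/-- A value that is recorded more than `60 %` of the times leaves less than `40 %` for every other
value, and is thus the only entry of `Solution`. -/
lemma algo_eq_of_lt_record {ι : Type*} {D : ℕ} [NeZero D] (S : Finset ι) (y : ι → ℝ) {l : Fin D}
    (h : 3 * S.card < 5 * record D S y l) : algo S y = l := by
  have hf : ((List.finRange D).filter fun m => 40 * S.card ≤ 100 * record D S y m) = [l] := by
    have : ∀ m ∈ List.finRange D,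
        decide (40 * S.card ≤ 100 * record D S y m) = decide (m = l) := by
      intro m _
      rw [decide_eq_decide]
      constructor
      · intro hm
        by_contra hne
        have := record_add_record_le S y hne
        omega
      · rintro rfl
        omega
    rw [List.filter_congr this, List.filter_eq, List.count_eq_one_of_mem (List.nodup_finRange D)
      (List.mem_finRange l), List.replicate_one]
  have hs : solution S.card (record D S y) = [l] := by
    simp only [solution, hf]
    simp
  simp [algo, hs]

/-- If `δ` is in the middle of its range, then `Algo` finds `l` except with probability exponentially
small in the number of measured qudits. -/
lemma pi_real_algo_ne_le {ι : Type*} [Fintype ι] {D : ℕ} [NeZero D] (θ : ι → ℝ) (S : Finset ι)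
    (l : Fin D) {δ : ℝ} (h1 : 0.35 * (2 * Real.pi / D) ≤ δ) (h2 : δ ≤ 0.65 * (2 * Real.pi / D))
    (hθ : ∀ i ∈ S, θ i = 2 * Real.pi * (l : ℕ) / D + δ) :
    (Measure.pi fun i => angleLaw D (phaseState D (θ i))).real {y | algo S y ≠ l} ≤
      Real.exp (-0.005 * S.card) := by
  have h := pi_real_sum_indicator_le (fun i => angleLaw D (phaseState D (θ i))) S
    (B := angleBin l) measurableSet_Ico (q := 0.65) (η := 0.05) (by norm_num)
    fun i hi => by rw [hθ i hi]; exact le_angleLaw_angleBin l h1 h2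
  refine (measureReal_mono ?_).trans (h.trans (le_of_eq ?_))
  · intro y hy
    by_contra hlt
    refine hy (algo_eq_of_lt_record S y ?_)
    have hr : (record D S y l : ℝ) = ∑ i ∈ S, (angleBin l).indicator (fun _ => (1 : ℝ)) (y i) := by
      unfold record
      push_cast
      refine Finset.sum_congr rfl fun i _ => ?_
      change (((angleBin l).indicator (fun _ => 1) (y i) : ℕ) : ℝ) = _
      by_cases hi : y i ∈ angleBin l <;> simp [hi]
    rw [Set.mem_ofPred_eq, not_le, ← hr] at hlt
    have : (3 * S.card : ℝ) < 5 * record D S y l := by linarith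
    exact_mod_cast this
  · norm_num

/-! ### The amplitude of the tallier's outcome -/

lemma transferCast_zero {D : ℕ} (φ : ℝ) (r : Fin D) : transferCast 0 φ r = castBallot r := by
  simp [transferCast, opC, opCorrect]

lemma transferCast_apply {D : ℕ} [NeZero D] (d : ℕ) (φ : ℝ) (r : Fin D) (x z : Fin D × Fin D) :
    transferCast d φ r x z = if x.1 = x.2 ∧ z = (x.1, x.2 - r) then
      (if x.2 < r then Complex.exp (((-(D * d * φ) : ℝ) : ℂ) * Complex.I) else 1) *
        Complex.exp ((((((x.2 - r : Fin D) : ℕ) : ℝ) * d * φ : ℝ) : ℂ) * Complex.I) else 0 := by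
  have hiff : (x = (z.1, z.2 + r) ∧ z.1 = z.2 + r) ↔ (x.1 = x.2 ∧ z = (x.1, x.2 - r)) := by
    obtain ⟨x1, x2⟩ := x
    obtain ⟨z1, z2⟩ := z
    simp only [Prod.mk.injEq]
    constructor
    · rintro ⟨⟨rfl, rfl⟩, h⟩
      exact ⟨h, rfl, by abel⟩
    · rintro ⟨rfl, rfl, rfl⟩
      exact ⟨⟨rfl, by abel⟩, by abel⟩
  have h : transferCast d φ r x z = if x = (z.1, z.2 + r) ∧ z.1 = z.2 + r then
      (if x.2 < r then Complex.exp (((-(D * d * φ) : ℝ) : ℂ) * Complex.I) else 1) *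
        Complex.exp ((((z.2 : ℕ) : ℝ) * d * φ : ℝ) * Complex.I) else 0 := by
    rw [transferCast, opC, Matrix.mul_diagonal, opCorrect, Matrix.diagonal_mul, castBallot, projP,
      Matrix.mul_diagonal, shiftU, Matrix.of_apply]
    by_cases h1 : x = (z.1, z.2 + r) <;> by_cases h2 : z.1 = z.2 + r <;> simp [h1, h2]
  rw [h]
  simp only [hiff]
  by_cases hc : x.1 = x.2 ∧ z = (x.1, x.2 - r)
  · rw [if_pos hc, if_pos hc, hc.2]
  · rw [if_neg hc, if_neg hc]

lemma blankBallot_const {N D : ℕ} [NeZero N] (j : Fin D) :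
    blankBallot N D (fun _ => j) = ((1 / Real.sqrt D : ℝ) : ℂ) := by
  simp [blankBallot]

lemma tallyAmp_eq_sum {N D : ℕ} [NeZero N] (p : Params D) (r : Fin N → Fin D) (ψ : Reg N D → ℂ)
    (q : Fin D) : tallyAmp p r ψ q = ((1 / Real.sqrt D : ℝ) : ℂ) * ∑ j : Fin D,
      Complex.exp (-(2 * Real.pi * Complex.I * (j : ℕ) * (q : ℕ) / D)) *
        tallyState p r ψ fun _ => (j, j) := by
  have h : ∀ s : Reg N D, star (omega N D q s) * tallyState p r ψ s =
      ∑ j : Fin D, if s = fun _ => (j, j) then ((1 / Real.sqrt D : ℝ) : ℂ) *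
        (Complex.exp (-(2 * Real.pi * Complex.I * (j : ℕ) * (q : ℕ) / D)) *
          tallyState p r ψ fun _ => (j, j)) else 0 := by
    intro s
    have hs : star (omega N D q s) = ((1 / Real.sqrt D : ℝ) : ℂ) * ∑ j : Fin D,
        if s = fun _ => (j, j) then
          Complex.exp (-(2 * Real.pi * Complex.I * (j : ℕ) * (q : ℕ) / D)) else 0 := by
      simp only [omega, Complex.star_def, map_mul, Complex.conj_ofReal, map_sum]
      congr 1
      refine Finset.sum_congr rfl fun j _ => ?_
      rw [apply_ite (starRingEnd ℂ), map_zero, ← Complex.exp_conj]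
      refine if_congr funext_iff.symm ?_ rfl
      simp [map_div₀, Complex.conj_ofNat, neg_div]
    rw [hs, Finset.mul_sum, Finset.sum_mul]
    refine Finset.sum_congr rfl fun j _ => ?_
    by_cases hj : s = fun _ => (j, j)
    · rw [if_pos hj, if_pos hj, hj, mul_assoc]
    · rw [if_neg hj, if_neg hj, mul_zero, zero_mul]
  rw [tallyAmp]
  simp only [h]
  rw [Finset.sum_comm, Finset.mul_sum]
  refine Finset.sum_congr rfl fun j _ => ?_
  rw [Finset.sum_ite_eq' Finset.univ (fun _ => (j, j)), if_pos (Finset.mem_univ _)]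

lemma tensorApply_const {N D : ℕ} [NeZero D] (K : Fin N → PairOp D) (ψ : Reg N D → ℂ)
    (j : Fin D) (z : Reg N D) (hK : ∀ k w, w ≠ z k → K k (j, j) w = 0) :
    tensorApply K ψ (fun _ => (j, j)) = (∏ k, K k (j, j) (z k)) * ψ z := by
  rw [tensorApply]
  refine Finset.sum_eq_single z (fun t _ ht => ?_) (by simp)
  obtain ⟨k, hk⟩ := Function.ne_iff.1 ht
  rw [Finset.prod_eq_zero (Finset.mem_univ k) (hK k _ hk), zero_mul]

/-- `θ_y - θ_n` is the multiple `l_y - l_n mod D` of `2π / D`, up to a multiple of `2π`. -/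
lemma exists_theta_sub_theta {D : ℕ} [NeZero D] (p : Params D) (v : Bool) :
    ∃ m : ℤ, p.theta v - p.theta false =
      2 * Real.pi * (v.toNat * p.diff : ℕ) / D + 2 * Real.pi * m := by
  have hD : (D : ℝ) ≠ 0 := by exact_mod_cast NeZero.ne D
  cases v with
  | false => exact ⟨0, by simp⟩
  | true =>
    rcases le_or_gt (p.l false) (p.l true) with h | h
    · refine ⟨0, ?_⟩
      have h1 := Fin.coe_sub_iff_le.2 h
      have h2 : (p.l false : ℕ) ≤ p.l true := h
      simp only [Params.theta, Params.diff, h1, Bool.toNat_true, one_mul, Nat.cast_sub h2]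
      push_cast
      ring
    · refine ⟨-1, ?_⟩
      have h1 := Fin.coe_sub_iff_lt.2 h
      have h2 : (p.l false : ℕ) ≤ D + p.l true := by have := (p.l false).2; omega
      simp only [Params.theta, Params.diff, h1, Bool.toNat_true, one_mul, Nat.cast_sub h2]
      push_cast
      field_simp
      ring

/-- The phase that one voter contributes to the branch `|j⟩`. Up to a factor that does not depend on
`j` it is the phase of the voter's yes votes; the two corrections remove what the reductions modulo
`D` of `j - r` would add. -/
lemma voter_phase {D : ℕ} [NeZero D] (p : Params D) (v : Bool) (d : ℕ) (r j : Fin D) {φ : ℝ}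
    (hφ : φ = 2 * Real.pi * p.diff / D) :
    Complex.exp (-Complex.I * (j : ℕ) * p.theta false) * (corrW p r j *
      ((if j < r then Complex.exp (((-(D * d * φ) : ℝ) : ℂ) * Complex.I) else 1) *
        Complex.exp ((((((j - r : Fin D) : ℕ) : ℝ) * d * φ : ℝ) : ℂ) * Complex.I) *
        Complex.exp (Complex.I * ((j - r : Fin D) : ℕ) * p.theta v))) =
      Complex.exp (((-((r : ℕ) * (p.theta v + d * φ)) : ℝ) : ℂ) * Complex.I) *
        Complex.exp (2 * Real.pi * Complex.I * (j : ℕ) * ((v.toNat + d) * p.diff : ℕ) / D) := by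
  have hD : (D : ℂ) ≠ 0 := by exact_mod_cast NeZero.ne D
  have hD' : (D : ℝ) ≠ 0 := by exact_mod_cast NeZero.ne D
  obtain ⟨m, hm⟩ := exists_theta_sub_theta p v
  have hφ' : (φ : ℂ) = 2 * Real.pi * p.diff / D := by rw [hφ]; push_cast; rfl
  have hm' : (p.theta v : ℂ) - p.theta false =
      2 * Real.pi * (v.toNat * p.diff) / D + 2 * Real.pi * m := by
    rw [← Complex.ofReal_sub, hm]
    push_cast
    rfl
  have hl : (D : ℂ) * p.theta v = 2 * Real.pi * (p.l v : ℕ) + D * p.2.2 := by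
    have : (D : ℝ) * p.theta v = 2 * Real.pi * (p.l v : ℕ) + D * p.2.2 := by
      rw [Params.theta]
      field_simp
    exact_mod_cast congrArg (fun x : ℝ => (x : ℂ)) this
  rcases le_or_gt r j with h | h
  · have h2 : (r : ℕ) ≤ j := h
    rw [corrW, if_neg h.not_gt, if_neg h.not_gt, Fin.coe_sub_iff_le.2 h, one_mul, one_mul,
      Nat.cast_sub h2, Nat.cast_sub h2, ← Complex.exp_add, ← Complex.exp_add, ← Complex.exp_add,
      Complex.exp_eq_exp_iff_exists_int]
    refine ⟨j * m, ?_⟩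
    push_cast
    linear_combination (Complex.I * (j : ℕ)) * hm' + (Complex.I * (j : ℕ) * d) * hφ'
  · have h2 : (r : ℕ) ≤ D + j := by have := r.2; omega
    rw [corrW, if_pos h, if_pos h, Fin.coe_sub_iff_lt.2 h,
      Nat.cast_sub h2, Nat.cast_sub h2, ← Complex.exp_add, ← Complex.exp_add, ← Complex.exp_add,
      ← Complex.exp_add, ← Complex.exp_add, Complex.exp_eq_exp_iff_exists_int]
    refine ⟨j * m + (p.l v : ℕ), ?_⟩
    push_cast
    linear_combination (Complex.I * (j : ℕ)) * hm' + (Complex.I * (j : ℕ) * d) * hφ' +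
      Complex.I * hl

/-- If voter `k` transfers `d k` votes with the exact value of `θ_y - θ_n`, then the tallier's outcome
is certainly the total number of yes votes, including the transferred ones, times `l_y - l_n`. The
announced results `r` are uniform: every amplitude has the modulus `D ^ (-N / 2)`. -/
lemma sum_norm_tallyAmp_transferCast {N D : ℕ} [NeZero N] [NeZero D] (p : Params D)
    (votes : Fin N → Bool) (d : Fin N → ℕ) {φ : ℝ} (hφ : φ = 2 * Real.pi * p.diff / D) (q : Fin D)
    (hq : (q : ℕ) = (∑ k, ((votes k).toNat + d k)) * p.diff) :
    ∑ r : Fin N → Fin D, ENNReal.ofReal (‖tallyAmp p r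
      (tensorApply (fun k => transferCast (d k) φ (r k)) (initState p votes)) q‖ ^ 2) = 1 := by
  have hD : (0 : ℝ) < D := by exact_mod_cast Nat.pos_of_ne_zero (NeZero.ne D)
  set u : ℂ := ((1 / Real.sqrt D : ℝ) : ℂ) with hu
  have huD : u * D * u = 1 := by
    rw [hu]
    norm_cast
    have := Real.mul_self_sqrt hD.le
    have h0 : Real.sqrt D ≠ 0 := (Real.sqrt_pos.2 hD).ne'
    field_simp
    linarith
  have key : ∀ r : Fin N → Fin D, tallyAmp p r
      (tensorApply (fun k => transferCast (d k) φ (r k)) (initState p votes)) q =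
      u ^ N * ∏ k, Complex.exp
        (((-((r k : ℕ) * (p.theta (votes k) + d k * φ)) : ℝ) : ℂ) * Complex.I) := by
    intro r
    have hj : ∀ j : Fin D, Complex.exp (-(2 * Real.pi * Complex.I * (j : ℕ) * (q : ℕ) / D)) *
        tallyState p r (tensorApply (fun k => transferCast (d k) φ (r k)) (initState p votes))
          (fun _ => (j, j)) =
        u * (u ^ N * ∏ k, Complex.exp
          (((-((r k : ℕ) * (p.theta (votes k) + d k * φ)) : ℝ) : ℂ) * Complex.I)) := by
      intro j
      rw [tallyState, tensorApply_const _ _ j (fun k => (j, j - r k))]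
      · have h1 : Complex.exp (-Complex.I * (j : ℕ) * N * p.theta false) =
            ∏ _k : Fin N, Complex.exp (-Complex.I * (j : ℕ) * p.theta false) := by
          rw [Finset.prod_const, ← Complex.exp_nat_mul, Finset.card_univ, Fintype.card_fin]
          congr 1
          ring
        have h2 : ∏ k, Complex.exp (2 * Real.pi * Complex.I * (j : ℕ) *
            (((votes k).toNat + d k) * p.diff : ℕ) / D) =
              Complex.exp (2 * Real.pi * Complex.I * (j : ℕ) * (q : ℕ) / D) := by
          rw [← Complex.exp_sum, hq, Finset.sum_mul, Nat.cast_sum, Finset.mul_sum, Finset.sum_div]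
        have h3 := Finset.prod_congr rfl fun k (_ : k ∈ Finset.univ) =>
          voter_phase p (votes k) (d k) (r k) j hφ
        simp only [Finset.prod_mul_distrib] at h3
        rw [← h1, h2] at h3
        simp only [initState, blankBallot_const, phaseState, Finset.prod_mul_distrib,
          transferCast_apply, and_self, if_true, Finset.prod_const, Finset.card_univ,
          Fintype.card_fin, ← hu]
        have h4 : Complex.exp (-(2 * Real.pi * Complex.I * (j : ℕ) * (q : ℕ) / D)) *
            Complex.exp (2 * Real.pi * Complex.I * (j : ℕ) * (q : ℕ) / D) = 1 := by
          rw [← Complex.exp_add, neg_add_cancel, Complex.exp_zero]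
        linear_combination
          (u ^ (N + 1) * Complex.exp (-(2 * Real.pi * Complex.I * (j : ℕ) * (q : ℕ) / D))) * h3 +
          (u ^ (N + 1) * ∏ k, Complex.exp
            (((-((r k : ℕ) * (p.theta (votes k) + d k * φ)) : ℝ) : ℂ) * Complex.I)) * h4
      · intro k w hw
        rw [transferCast_apply, if_neg fun h => hw h.2]
    rw [tallyAmp_eq_sum]
    simp only [hj, Finset.sum_const, Finset.card_univ, Fintype.card_fin, nsmul_eq_mul]
    linear_combination (u ^ N * ∏ k, Complex.exp
      (((-((r k : ℕ) * (p.theta (votes k) + d k * φ)) : ℝ) : ℂ) * Complex.I)) * huD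
  have hnorm : ∀ r : Fin N → Fin D, ‖tallyAmp p r
      (tensorApply (fun k => transferCast (d k) φ (r k)) (initState p votes)) q‖ ^ 2 =
      1 / (D : ℝ) ^ N := by
    intro r
    have hun : ‖u‖ ^ 2 = 1 / D := by
      rw [hu, Complex.norm_real, Real.norm_eq_abs, sq_abs, div_pow, Real.sq_sqrt hD.le, one_pow]
    rw [key, norm_mul, norm_prod]
    simp only [Complex.norm_exp_ofReal_mul_I, Finset.prod_const_one, mul_one]
    rw [norm_pow, ← pow_mul, mul_comm, pow_mul, hun, div_pow, one_pow]
  simp only [hnorm, Finset.sum_const, Finset.card_univ, Fintype.card_pi, Fintype.card_fin,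
    Finset.prod_const]
  rw [nsmul_eq_mul, one_div, ENNReal.ofReal_inv_of_pos (by positivity),
    ENNReal.ofReal_pow hD.le, ENNReal.ofReal_natCast, Nat.cast_pow]
  refine ENNReal.mul_inv_cancel (pow_ne_zero _ ?_) (ENNReal.pow_ne_top (ENNReal.natCast_ne_top D))
  exact_mod_cast NeZero.ne D

/-! ### One round against the `d`-transfer adversary -/

namespace TransferPlan

variable {N : ℕ} {ε : ℝ}

lemma card_leftover (P : TransferPlan N ε) (v : Bool) :
    (P.leftover v).card = ⌊(ε * N - 1) / 2⌋₊ := by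
  rw [← P.card_half (!v), ← Finset.card_map (Function.Embedding.subtype _)]
  congr 1
  ext k
  simp only [leftover, Finset.mem_map, Finset.mem_filter, Finset.mem_univ, true_and,
    Function.Embedding.subtype_apply, Subtype.exists, Finset.mem_erase, exists_and_right,
    exists_eq_right]
  constructor
  · rintro ⟨⟨hk, h1⟩, h2⟩
    exact ⟨⟨h1, hk⟩, h2⟩
  · rintro ⟨⟨h1, hk⟩, h2⟩
    exact ⟨⟨hk, h1⟩, h2⟩

lemma yesVotes_add_card_no (P : TransferPlan N ε) :
    P.yesVotes + (Finset.univ.filter fun k => P.votes k = false).card = N := by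
  have := Finset.card_filter_add_card_filter_not (s := Finset.univ) fun k => P.votes k = true
  simpa [yesVotes] using this

lemma sum_yes_add_transfer (P : TransferPlan N ε) :
    ∑ k, ((P.votes k).toNat + if k = P.t then P.d else 0) = P.yesVotes + P.d := by
  rw [Finset.sum_add_distrib, Finset.sum_ite_eq', if_pos (Finset.mem_univ _), yesVotes,
    Finset.card_filter]
  congr 1
  refine Finset.sum_congr rfl fun k _ => ?_
  cases P.votes k <;> rfl

lemma kraus_dTransferAdversary {D : ℕ} [NeZero D] (P : TransferPlan N ε)
    (y : {k // k ∈ P.corrupted} → ℝ) (k : Fin N) (r : Fin D) :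
    (dTransferAdversary D P).kraus y k r =
      transferCast (if k = P.t then P.d else 0) (P.angleEstimate D y) r := by
  have h : (dTransferAdversary D P).kraus y k r = if k ∈ P.corrupted then
      (if k = P.t then transferCast P.d (P.angleEstimate D y) r else castBallot r)
        else castBallot r := rfl
  rw [h]
  by_cases ht : k = P.t
  · rw [if_pos ht, if_pos ht, if_pos (ht ▸ P.t_mem)]
  · rw [if_neg ht, if_neg ht, transferCast_zero, ite_self]

end TransferPlan

/-- For an offset `δ` in the middle of its range, all voters' yes votes and the `d` transferred ones
are counted in a round whenever `Algo` finds both `l_y` and `l_n`. -/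
lemma le_roundProb_dTransferAdversary {N D : ℕ} [NeZero N] [NeZero D] {ε : ℝ}
    (P : TransferPlan N ε) (p : Params D) (h1 : 0.35 * (2 * Real.pi / D) ≤ p.2.2)
    (h2 : p.2.2 ≤ 0.65 * (2 * Real.pi / D)) (q : Fin D)
    (hq : (q : ℕ) = (P.yesVotes + P.d) * p.diff) :
    ENNReal.ofReal (1 - 2 * Real.exp (-0.005 * ⌊(ε * N - 1) / 2⌋₊)) ≤
      (dTransferAdversary D P).roundProb p q := by
  set ν : Measure ({k // k ∈ P.corrupted} → ℝ) :=
    Measure.pi fun k => angleLaw D (phaseState D (p.theta (!P.votes k)))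
  set B : Bool → Set ({k // k ∈ P.corrupted} → ℝ) := fun v => {y | algo (P.leftover v) y ≠ p.l v}
  have hBm : ∀ v, MeasurableSet (B v) := fun v =>
    (measurable_algo (P.leftover v) (measurableSet_singleton (p.l v))).compl
  have hBle : ∀ v, ν.real (B v) ≤ Real.exp (-0.005 * ⌊(ε * N - 1) / 2⌋₊) := by
    intro v
    rw [← P.card_leftover v]
    refine pi_real_algo_ne_le (fun k : {k // k ∈ P.corrupted} => p.theta (!P.votes k))
      (P.leftover v) (p.l v) h1 h2 ?_
    intro k hk
    have hv : (!P.votes k) = v := by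
      have := (Finset.mem_filter.1 hk).2.2
      rw [this, Bool.not_not]
    simp only [hv, Params.theta]
  have hG : ENNReal.ofReal (1 - 2 * Real.exp (-0.005 * ⌊(ε * N - 1) / 2⌋₊)) ≤
      ν (B true ∪ B false)ᶜ := by
    rw [← ofReal_measureReal]
    refine ENNReal.ofReal_le_ofReal ?_
    rw [probReal_compl_eq_one_sub ((hBm true).union (hBm false))]
    have := measureReal_union_le (μ := ν) (B true) (B false)
    linarith [hBle true, hBle false]
  refine hG.trans ?_
  have hround : (dTransferAdversary D P).roundProb p q =
      ∫⁻ y, ∑ r : Fin N → Fin D, ENNReal.ofReal (‖tallyAmp p r (tensorApply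
        (fun k => transferCast (if k = P.t then P.d else 0) (P.angleEstimate D y) (r k))
        (initState p P.votes)) q‖ ^ 2) ∂ν := by
    simp only [← P.kraus_dTransferAdversary]
    rfl
  rw [← lintegral_indicator_one ((hBm true).union (hBm false)).compl, hround]
  refine lintegral_mono fun y => ?_
  by_cases hy : y ∈ (B true ∪ B false)ᶜ
  · rw [Set.indicator_of_mem hy]
    have hy1 : algo (P.leftover true) y = p.l true := by
      by_contra h
      exact hy (Or.inl h)
    have hy2 : algo (P.leftover false) y = p.l false := by
      by_contra h
      exact hy (Or.inr h)
    have hφ : P.angleEstimate D y = 2 * Real.pi * p.diff / D := by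
      rw [TransferPlan.angleEstimate, hy1, hy2, Params.diff]
    exact (sum_norm_tallyAmp_transferCast p P.votes (fun k => if k = P.t then P.d else 0) hφ q
      (by rw [P.sum_yes_add_transfer, hq])).ge
  · rw [Set.indicator_of_notMem hy]
    exact zero_le

/-! ### The election -/

lemma IsSetupLaw.measure_offset {N D : ℕ} [NeZero D] {μ : Measure (Params D)}
    (hμ : IsSetupLaw N D μ) :
    μ {p | p.2.2 ∈ Set.Icc (0.35 * (2 * Real.pi / D)) (0.65 * (2 * Real.pi / D))} =
      ENNReal.ofReal 0.3 := by
  have hD : (0 : ℝ) < D := by exact_mod_cast Nat.pos_of_ne_zero (NeZero.ne D)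
  have hτ : 0 < 2 * Real.pi / D := by have := Real.pi_pos; positivity
  have hu := hμ.uniform
  generalize 2 * Real.pi / (D : ℝ) = τ at hu hτ ⊢
  have hf : Measurable fun p : Params D => (p.1, p.2.2) := by fun_prop
  have : IsProbabilityMeasure (uniformOn (Set.univ : Set (Fin D))) :=
    isProbabilityMeasure_uniformOn Set.finite_univ Set.univ_nonempty
  have h := DFunLike.congr_fun hu (Set.univ ×ˢ Set.Icc (0.35 * τ) (0.65 * τ))
  rw [Measure.map_apply hf (MeasurableSet.univ.prod measurableSet_Icc), Measure.prod_prod,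
    measure_univ, one_mul, cond_apply measurableSet_Ico,
    Set.inter_eq_right.2 (Set.Icc_subset_Ico_iff (by linarith) |>.2 ⟨by linarith, by linarith⟩),
    Real.volume_Ico, Real.volume_Icc, ← ENNReal.ofReal_inv_of_pos (by linarith),
    ← ENNReal.ofReal_mul (by rw [inv_nonneg]; linarith)] at h
  convert h using 2
  · ext p
    simp
  · field_simp [hτ.ne']
    ring

/-- The agreement of all rounds on the yes votes and the transferred votes, when each round fails
with probability at most `f` and `ρ f ≤ 1 / 6`: the offset is in the middle of its range with
probability `0.3`. -/
lemma le_resultProb_dTransferAdversary {N D ρ : ℕ} [NeZero N] [NeZero D] {ε : ℝ}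
    (hρ : 0 < ρ) (hf : ρ * (2 * Real.exp (-0.005 * ⌊(ε * N - 1) / 2⌋₊)) ≤ 1 / 6)
    {μ : Measure (Params D)} (hμ : IsSetupLaw N D μ) (P : TransferPlan N ε) :
    1 / 4 ≤ (dTransferAdversary D P).resultProb μ ρ fun X => X = some (P.yesVotes + P.d) := by
  set f := 2 * Real.exp (-0.005 * ⌊(ε * N - 1) / 2⌋₊)
  have hf0 : 0 ≤ f := by positivity
  have hf1 : f ≤ 1 / 6 := by
    have : (1 : ℝ) ≤ ρ := by exact_mod_cast hρ
    nlinarith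
  set G : Set (Params D) :=
    {p | p.2.2 ∈ Set.Icc (0.35 * (2 * Real.pi / D)) (0.65 * (2 * Real.pi / D))}
  have hGm : MeasurableSet G := measurableSet_Icc.preimage (by fun_prop)
  have hmd : P.yesVotes + P.d ≤ N := by
    have := P.yesVotes_add_card_no
    have := P.d_le
    omega
  calc (1 : ℝ≥0∞) / 4 = ENNReal.ofReal (5 / 6) * ENNReal.ofReal 0.3 := by
        rw [← ENNReal.ofReal_mul (by norm_num), show (5 / 6 * 0.3 : ℝ) = 1 / 4 by norm_num,
          ENNReal.ofReal_div_of_pos (by norm_num)]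
        simp
    _ = ∫⁻ p, G.indicator (fun _ => ENNReal.ofReal (5 / 6)) p ∂μ := by
        rw [lintegral_indicator_const hGm, hμ.measure_offset]
    _ ≤ _ := by
        refine lintegral_mono_ae ?_
        filter_upwards [hμ.admissible] with p hp
        by_cases hpG : p ∈ G
        · rw [Set.indicator_of_mem hpG]
          have hlt : (P.yesVotes + P.d) * p.diff < D :=
            (Nat.mul_le_mul_right _ hmd).trans_lt hp.2
          set q : Fin D := ⟨(P.yesVotes + P.d) * p.diff, hlt⟩ with hq
          have hdec : electionResult (fun _ : Fin ρ => decode p (some q)) =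
              some (P.yesVotes + P.d) := by
            have : decode p (some q) = some (P.yesVotes + P.d) := by
              simp [decode, hq, Nat.pos_of_ne_zero hp.1]
            simp [electionResult, hρ, this]
          -- Only the term in which every round has the outcome `q` is kept.
          refine le_trans ?_ (Finset.single_le_sum (fun _ _ => zero_le)
            (Finset.mem_univ fun _ => some q))
          rw [if_pos hdec, Finset.prod_const, Finset.card_univ, Fintype.card_fin]
          calc ENNReal.ofReal (5 / 6) ≤ ENNReal.ofReal ((1 - f) ^ ρ) := by
                refine ENNReal.ofReal_le_ofReal ?_
                have := one_add_mul_le_pow (a := -f) (by linarith) ρ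
                rw [← sub_eq_add_neg] at this
                linarith
            _ = ENNReal.ofReal (1 - f) ^ ρ := ENNReal.ofReal_pow (by linarith) ρ
            _ ≤ _ := pow_le_pow_left' (le_roundProb_dTransferAdversary P p hpG.1 hpG.2 q rfl) ρ
        · rw [Set.indicator_of_notMem hpG]
          exact zero_le

lemma Adversary.resultProb_mono {N D : ℕ} [NeZero N] (A : Adversary N D) (μ : Measure (Params D))
    (ρ : ℕ) {E F : Option ℕ → Prop} (h : ∀ X, E X → F X) :
    A.resultProb μ ρ E ≤ A.resultProb μ ρ F := by
  refine lintegral_mono fun p => Finset.sum_le_sum fun q _ => ?_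
  split_ifs with h1 h2
  · exact le_rfl
  · exact absurd (h _ h1) h2
  · exact zero_le
  · exact le_rfl

/-- Transferring more votes than the corrupted no voters have leaves too few no votes for the honest
voters. -/
lemma wins_dTransferAdversary {N D : ℕ} [NeZero D] {ε : ℝ} (P : TransferPlan N ε)
    (h : (P.corrupted.filter fun k => P.votes k = false).card < P.d) :
    (dTransferAdversary D P).Wins (some (P.yesVotes + P.d)) := by
  refine ⟨_, rfl, Or.inl fun hc => ?_⟩
  have h1 : (dTransferAdversary D P).honestCount false +
      (P.corrupted.filter fun k => P.votes k = false).card =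
        (Finset.univ.filter fun k => P.votes k = false).card := by
    have := Finset.card_filter_add_card_filter_not
      (s := Finset.univ.filter fun k => P.votes k = false) fun k => k ∈ P.corrupted
    rw [Finset.filter_filter, Finset.filter_filter, add_comm] at this
    rw [← this, Adversary.honestCount]
    congr 2
    · exact Finset.filter_congr fun k _ => and_comm
    · ext k
      simp [and_comm]
  have h2 := P.yesVotes_add_card_no
  have h3 := P.d_le
  have h4 := hc.2
  omega

/-! ### Existence of winning choices -/

lemma card_filter_fin_Ico {N a b : ℕ} (hb : b ≤ N) :
    (Finset.univ.filter fun k : Fin N => a ≤ (k : ℕ) ∧ (k : ℕ) < b).card = b - a := by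
  rw [← Nat.card_Ico, ← Finset.card_map Fin.valEmbedding]
  congr 1
  ext k
  simp only [Finset.mem_map, Finset.mem_filter, Finset.mem_univ, true_and, Fin.valEmbedding_apply,
    Finset.mem_Ico]
  constructor
  · rintro ⟨k, h, rfl⟩
    exact h
  · intro h
    exact ⟨⟨k, by omega⟩, h, rfl⟩

/-- With `n` the prescribed half, the voters `0, …, n` vote yes, all others vote no, and the voters
`0, …, 2n` are corrupted; all no votes are transferred by voter `0`. -/
lemma exists_transferPlan {N : ℕ} [NeZero N] {ε : ℝ} (hε : ε < 1) (hN : 1 ≤ ε * N) :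
    ∃ P : TransferPlan N ε, (P.corrupted.filter fun k => P.votes k = false).card < P.d := by
  set n := ⌊(ε * N - 1) / 2⌋₊ with hn
  have hn1 : (2 * n + 1 : ℝ) ≤ ε * N := by
    have := Nat.floor_le (a := (ε * N - 1) / 2) (by linarith)
    rw [← hn] at this
    linarith
  have hN0 : (0 : ℝ) < N := by exact_mod_cast Nat.pos_of_ne_zero (NeZero.ne N)
  have hn2 : 2 * n + 1 < N := by
    have : (2 * n + 1 : ℝ) < N := by nlinarith
    exact_mod_cast this
  have hno : (Finset.univ.filter fun k : Fin N => decide ((k : ℕ) ≤ n) = false).card =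
      N - (n + 1) := by
    rw [← card_filter_fin_Ico le_rfl]
    congr 1
    ext k
    have := k.2
    simp
  refine ⟨{ votes := fun k => decide ((k : ℕ) ≤ n)
            corrupted := Finset.univ.filter fun k => 0 ≤ (k : ℕ) ∧ (k : ℕ) < 2 * n + 1
            t := 0
            d := N - (n + 1)
            t_mem := by simp
            votes_t := by simp
            card_le := by
              rw [card_filter_fin_Ico hn2.le]
              push_cast
              linarith
            card_half := ?_
            d_pos := by omega
            d_le := hno.ge }, ?_⟩
  · have h0 : ∀ k : Fin N, k = 0 ↔ (k : ℕ) = 0 := fun k => by rw [Fin.ext_iff, Fin.val_zero]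
    rw [← hn]
    rintro (_ | _)
    · trans (2 * n + 1) - (n + 1)
      · rw [← card_filter_fin_Ico hn2.le]
        congr 1
        ext k
        simp only [Finset.mem_filter, Finset.mem_erase, Finset.mem_univ, true_and, ne_eq, h0,
          decide_eq_false_iff_not]
        omega
      · omega
    · trans (n + 1) - 1
      · rw [← card_filter_fin_Ico (N := N) (by omega)]
        congr 1
        ext k
        simp only [Finset.mem_filter, Finset.mem_erase, Finset.mem_univ, true_and, ne_eq, h0,
          decide_eq_true_eq]
        omega
      · omega
  · have : ((Finset.univ.filter fun k : Fin N => 0 ≤ (k : ℕ) ∧ (k : ℕ) < 2 * n + 1).filter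
        fun k : Fin N => decide ((k : ℕ) ≤ n) = false).card = (2 * n + 1) - (n + 1) := by
      rw [← card_filter_fin_Ico hn2.le]
      congr 1
      ext k
      simp
      omega
    refine lt_of_eq_of_lt this ?_
    change (2 * n + 1) - (n + 1) < N - (n + 1)
    omega

end QVote

theorem mainTheorem2 (ε : ℝ) (hε0 : 0 < ε) (hε1 : ε < 1) :
    ∃ c : ℝ, 0 < c ∧
      ∀ (N D ρ : ℕ) [NeZero N] [NeZero D], N < D → 2 ≤ ρ → (ρ : ℝ) ≤ Real.exp (c * N) →
        (∃ P : QVote.TransferPlan N ε,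
          ((P.corrupted.filter fun k => P.votes k = false).card < P.d)) ∧
        ∀ μ : MeasureTheory.Measure (QVote.Params D), QVote.IsSetupLaw N D μ →
          ∀ P : QVote.TransferPlan N ε,
            1 / 4 ≤ (QVote.dTransferAdversary D P).resultProb μ ρ
              (fun X => X = some (P.yesVotes + P.d)) ∧
            ((P.corrupted.filter fun k => P.votes k = false).card < P.d →
              1 / 4 ≤ (QVote.dTransferAdversary D P).qintProb μ ρ) := by
  refine ⟨ε / 4000, by positivity, fun N D ρ _ _ _ hρ hρc => ?_⟩
  -- Since `ρ ≥ 2`, the bound on `ρ` makes `ε * N` large: at least `4000 * log 2`.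
  have hN : 2760 ≤ ε * N := by
    have h2 : (2 : ℝ) ≤ Real.exp (ε / 4000 * N) := le_trans (by exact_mod_cast hρ) hρc
    have h3 : Real.log 2 ≤ ε / 4000 * N := (Real.log_le_iff_le_exp (by norm_num)).2 h2
    have := Real.log_two_gt_d9
    linarith
  -- The failure probability of a round beats the number of rounds.
  have hf : ρ * (2 * Real.exp (-0.005 * ⌊(ε * N - 1) / 2⌋₊)) ≤ 1 / 6 := by
    have hfl := Nat.lt_floor_add_one ((ε * N - 1) / 2)
    have he : Real.exp (ε / 4000 * N) * Real.exp (-0.005 * ⌊(ε * N - 1) / 2⌋₊) ≤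
        Real.exp (-6) := by
      rw [← Real.exp_add]
      refine Real.exp_le_exp.2 ?_
      linarith
    have h6 : Real.exp (-6) ≤ 1 / 12 := by
      rw [Real.exp_neg, inv_le_comm₀ (Real.exp_pos 6) (by norm_num)]
      have := Real.quadratic_le_exp_of_nonneg (x := 6) (by norm_num)
      linarith
    calc ρ * (2 * Real.exp (-0.005 * ⌊(ε * N - 1) / 2⌋₊))
        ≤ Real.exp (ε / 4000 * N) * (2 * Real.exp (-0.005 * ⌊(ε * N - 1) / 2⌋₊)) := by gcongr
      _ ≤ 1 / 6 := by linarith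
  refine ⟨QVote.exists_transferPlan hε1 (by linarith), fun μ hμ P => ?_⟩
  have h := QVote.le_resultProb_dTransferAdversary (by omega) hf hμ P
  refine ⟨h, fun hd => h.trans (QVote.Adversary.resultProb_mono _ μ ρ ?_)⟩
  rintro X rfl
  exact QVote.wins_dTransferAdversary P hd
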